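/- **Theorem 3.1 (Randomly pivoted Cholesky).** Let $A \in \mathbb{R}^{N\times N}$ be a (symmetric) positive semidefinite matrix. Randomly pivoted Cholesky (RPCholesky) with $k$ iterations starts from the factor matrix $F = 0 \in \mathbb{R}^{N\times k}$, the vector $d = \operatorname{diag} A \in \mathbb{R}^N$ and the pivot set $S = \emptyset$. In iteration $i = 1,\dots,k$ it draws a random pivot $s \in \{1,\dots,N\}$ with probabilities $d_s / \sum_{j=1}^N d_j$ (given the past), adds $s$ to $S$, computes $$g = A(:,s) - F(:,1\!:\!i-1)\,F(s,1\!:\!i-1)^{*}, \qquad F(:,i) \leftarrow g/\sqrt{g_s},$$ and replaces $d_j$ by $d_j - |F(j,i)|^2$ for every $j$. (If $d = 0$, the approximation is already exact, and the remaining iterations change nothing.) The column Nyström approximation that it produces is $\hat A^{(k)} = F F^{*}$. For $r \in \mathbb{N} = \{0,1,2,\dots\}$ let $⟦A⟧_r = \sum_{j=1}^{\min\{r,N\}} \lambda_j v_j v_j^{*}$ be the $r$-truncated eigenvalue decomposition of $A$, where $\lambda_1 \ge \dots \ge \lambda_N$ are the eigenvalues of $A$ and $v_1,\dots,v_N$ corresponding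 orthonormal eigenvectors. Put $$\eta = \frac{\operatorname{tr}(A - ⟦A⟧_r)}{\operatorname{tr} A}$$ (and $\eta = 0$ if $A = 0$), and let $\log_+ x = \max\{\log x, 0\}$ for $x>0$, with the natural logarithm. Then, for every $r \in \mathbb{N}$, every $\varepsilon > 0$ and every $k \in \mathbb{N}$ with $$k \;\ge\; \frac{r}{\varepsilon} + \min\Bigl\{\, r \log_+\Bigl(\frac{1}{\varepsilon\eta}\Bigr),\; r + r \log_+\Bigl(\frac{2^r}{\varepsilon}\Bigr) \Bigr\},$$ where the minimum is read as its second term if $\eta = 0$ (that is, $\log_+(1/0) = +\infty$), the random variable $\operatorname{tr}(A - \hat A^{(k)})$ is integrable and $$\mathbb{E}\, \operatorname{tr}\bigl(A - \hat A^{(k)}\bigr) \;\le\; (1+\varepsilon)\cdot \operatorname{tr}\bigl(A - ⟦A⟧_r\bigr).$$ -/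

import Mathlib

open scoped ENNReal

noncomputable section

/-- The variables held by the algorithm after `i` iterations of its loop: the factor matrix `F`
(the columns filled so far), the vector `d`, and the set `S` of selected pivots. -/
structure RPCState (N i : ℕ) where
  F : Matrix (Fin N) (Fin i) ℝ
  d : Fin N → ℝ
  S : Finset (Fin N)

/-- States are drawn from discrete distributions, so every set of states is an event. -/
instance (N i : ℕ) : MeasurableSpace (RPCState N i) := ⊤

namespace RPCState

variable {N i : ℕ}

/-- The Nyström approximation `Â = F Fᵀ` that is encoded by the factor matrix. -/
def approx (st : RPCState N i) : Matrix (Fin N) (Fin N) ℝ :=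
  st.F * st.F.transpose

/-- The initial state: no column of `F` is filled, no pivot is selected, and `d = diag A`. -/
def init (A : Matrix (Fin N) (Fin N) ℝ) : RPCState N 0 where
  F := 0
  d := A.diag
  S := ∅

/-- Processing of the pivot `s`, with
`g = A(:,s) - F F(s,:)ᵀ`, new column `g / √(g s)` of `F`, and `d ← d - |g / √(g s)|²`. -/
def update (A : Matrix (Fin N) (Fin N) ℝ) (st : RPCState N i) (s : Fin N) :
    RPCState N (i + 1) :=
  let g : Fin N → ℝ := fun j => A j s - st.F.mulVec (st.F s) j
  let f : Fin N → ℝ := fun j => g j / √(g s)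
  { F := Matrix.of fun j => Fin.snoc (α := fun _ => ℝ) (st.F j) (f j)
    d := fun j => st.d j - |f j| ^ 2
    S := insert s st.S }

/-- An idle iteration: the new column of `F` keeps its initial value zero. -/
def idle (st : RPCState N i) : RPCState N (i + 1) where
  F := Matrix.of fun j => Fin.snoc (α := fun _ => ℝ) (st.F j) 0
  d := st.d
  S := st.S

open Classical in
/-- One iteration: draw `s` with probability `d s / ∑ j, d j` and process it.
The entries of `d` are the diagonal entries of the residual `A - F Fᵀ`. When they are all zero
there is no such distribution; the approximation is then exact and the iteration is idle. -/
def step (A : Matrix (Fin N) (Fin N) ℝ) (st : RPCState N i) : PMF (RPCState N (i + 1)) :=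
  if h : ∑' j, ENNReal.ofReal (st.d j) = 0 then
    PMF.pure st.idle
  else
    (PMF.normalize (fun j => ENNReal.ofReal (st.d j)) h
      (by rw [tsum_fintype]; exact ENNReal.sum_ne_top.2 fun _ _ => ENNReal.ofReal_ne_top)).map
      (st.update A)

end RPCState

/-- Randomly pivoted Cholesky: the distribution of the state after `k` iterations. -/
def rpCholesky {N : ℕ} (A : Matrix (Fin N) (Fin N) ℝ) : (k : ℕ) → PMF (RPCState N k)
  | 0 => PMF.pure (RPCState.init A)
  | k + 1 => (rpCholesky A k).bind (RPCState.step A)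

/-- The `r`-truncated eigenvalue decomposition `⟦A⟧_r = ∑_{j < r} λ_j v_j v_jᵀ`. Here
`λ_0 ≥ λ_1 ≥ ⋯` is the decreasing list `hA.eigenvalues₀` of the eigenvalues of `A`, and `v_j` is
the eigenvector that belongs to it: Mathlib stores it in the orthonormal eigenbasis
`hA.eigenvectorBasis` under the index `Fintype.equivOfCardEq _ j`. -/
def truncEig {N : ℕ} {A : Matrix (Fin N) (Fin N) ℝ} (hA : A.IsHermitian) (r : ℕ) :
    Matrix (Fin N) (Fin N) ℝ :=
  ∑ j : Fin (Fintype.card (Fin N)),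
    if j.val < r then
      let v : Fin N → ℝ := fun x =>
        hA.eigenvectorBasis (Fintype.equivOfCardEq (Fintype.card_fin _) j) x
      hA.eigenvalues₀ j • Matrix.vecMulVec v v
    else 0

/-- The relative error `η = tr(A - ⟦A⟧_r) / tr A` (equal to `0` if `A = 0`). -/
def relErr {N : ℕ} {A : Matrix (Fin N) (Fin N) ℝ} (hA : A.IsHermitian) (r : ℕ) : ℝ :=
  (A - truncEig hA r).trace / A.trace

/-- The number of columns
`r/ε + min {r log₊(1/(εη)), r + r log₊(2^r/ε)}`, where `log₊ x = max {log x, 0}`. If `η = 0` then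
`log₊(1/(εη)) = +∞`, so that the minimum is its second term. -/
def columnBound (r : ℕ) (ε η : ℝ) : ℝ :=
  r / ε +
    if η = 0 then r + r * max (Real.log (2 ^ r / ε)) 0
    else min (r * max (Real.log (1 / (ε * η))) 0) (r + r * max (Real.log (2 ^ r / ε)) 0)

end

/-! Write `R` for the residual `A - F Fᵀ`. Processing the pivot `s` replaces `R` by its Schur
complement, and `s` is drawn with probability `R s s / tr R`, so the expected new residual is `R -
R² / tr R`. Let `P` project onto the top `r` eigenvectors and put `b = tr (A - P A)`, the optimal
error in the theorem. Since `F Fᵀ` is positive semidefinite, the tail `tr ((1 - P) R)` never exceeds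
`b`. It remains to bring the expected head `x = tr (P R)` below `ε b`.

By Cauchy-Schwarz, `x² ≤ r tr (P R²)`, so one iteration has expected head at most `x - x² / (r (x +
b))` (`expect_step_head_le`). This function is concave and increasing, so its iterates bound the
expected heads (`expect_head_add_le`). From a start `a ≤ c b`, about `r / ε + r log₊ (c / ε)` steps
suffice (`iterate_headStep_le`).

There are two starting points. At time `0` the head is at most `tr A = b / η`, which gives `c = 1 /
η`. At time `r` the expected residual trace is at most `2 ^ r b`, which gives `c = 2 ^ r` for `r`
extra steps. For the latter, split `R = L + T` into positive semidefinite parts: a random pivot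
lowers the rank bound on `L` by one while at most doubling the expected trace of `T`
(`expect_step_psdTail_le`). -/

open scoped ENNReal
open Matrix

/-! ### Schur complements on the positive semidefinite cone. -/

namespace Matrix

variable {n : Type*}

/-- The Schur complement of the pivot `s` in `M`, embedded in the full matrix. If `M s s = 0`, then
the matrix is left unchanged. -/
noncomputable def pivotElim (M : Matrix n n ℝ) (s : n) : Matrix n n ℝ :=
  M - (M s s)⁻¹ • vecMulVec (fun j => M j s) (fun j => M j s)

theorem IsHermitian.pivotElim {M : Matrix n n ℝ} (hM : M.IsHermitian) (s : n) :
    (M.pivotElim s).IsHermitian := by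
  ext i j
  have := hM.apply i j
  simp only [star_trivial] at this
  simp [Matrix.pivotElim, vecMulVec_apply, this, mul_comm]

variable [Fintype n]

theorem posSemidef_real_iff {M : Matrix n n ℝ} :
    M.PosSemidef ↔ M.IsHermitian ∧ ∀ x : n → ℝ, 0 ≤ x ⬝ᵥ M *ᵥ x := by
  simp [posSemidef_iff_dotProduct_mulVec]

theorem PosSemidef.quadForm_nonneg {M : Matrix n n ℝ} (hM : M.PosSemidef) (x : n → ℝ) :
    0 ≤ x ⬝ᵥ M *ᵥ x :=
  (posSemidef_real_iff.1 hM).2 x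

theorem IsHermitian.col_dotProduct {M : Matrix n n ℝ} (hM : M.IsHermitian) (s : n) (x : n → ℝ) :
    (fun j => M j s) ⬝ᵥ x = (M *ᵥ x) s := by
  have : (fun j => M j s) = M s := by
    ext j
    simpa using hM.apply s j
  rw [this]
  rfl

theorem quadForm_vecMulVec_self (v x : n → ℝ) : x ⬝ᵥ vecMulVec v v *ᵥ x = (v ⬝ᵥ x) ^ 2 := by
  rw [vecMulVec_mulVec, dotProduct_smul, dotProduct_comm x v]
  simp [sq]

theorem IsHermitian.quadForm_pivotElim {M : Matrix n n ℝ} (hM : M.IsHermitian) (s : n)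
    (x : n → ℝ) :
    x ⬝ᵥ M.pivotElim s *ᵥ x = x ⬝ᵥ M *ᵥ x - (M s s)⁻¹ * ((M *ᵥ x) s) ^ 2 := by
  rw [Matrix.pivotElim, sub_mulVec, dotProduct_sub, smul_mulVec, dotProduct_smul,
    quadForm_vecMulVec_self, hM.col_dotProduct, smul_eq_mul]

theorem trace_pivotElim (M : Matrix n n ℝ) (s : n) :
    (M.pivotElim s).trace = M.trace - (M s s)⁻¹ * ∑ j, M j s ^ 2 := by
  simp [pivotElim, trace_sub, trace_smul, trace_vecMulVec, dotProduct, sq]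

theorem PosSemidef.trace_mul_nonneg {L T : Matrix n n ℝ} (hL : L.PosSemidef)
    (hT : T.PosSemidef) : 0 ≤ (L * T).trace := by
  obtain ⟨m, v, rfl⟩ := posSemidef_iff_eq_sum_vecMulVec.1 hL
  rw [trace_mul_comm, Finset.mul_sum, trace_sum]
  refine Finset.sum_nonneg fun i _ => ?_
  rw [mul_vecMulVec, trace_vecMulVec, dotProduct_comm]
  simpa using hT.quadForm_nonneg (v i)

/-- The cross term in the expanded square is `2 tr (L T)`, which is nonnegative. -/
theorem PosSemidef.sum_sq_le_sum_sq_add {L T : Matrix n n ℝ} (hL : L.PosSemidef)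
    (hT : T.PosSemidef) : ∑ s, ∑ j, L j s ^ 2 ≤ ∑ s, ∑ j, (L + T) j s ^ 2 := by
  have h := hL.trace_mul_nonneg hT
  have e : (L * T).trace = ∑ s, ∑ j, L j s * T j s := by
    rw [trace, Finset.sum_comm]
    refine Finset.sum_congr rfl fun i _ => ?_
    rw [diag_apply, mul_apply]
    refine Finset.sum_congr rfl fun j _ => ?_
    rw [show T j i = T i j by simpa using hT.isHermitian.apply i j]
  have : ∑ s, ∑ j, (L + T) j s ^ 2 =
      ∑ s, ∑ j, L j s ^ 2 + 2 * (∑ s, ∑ j, L j s * T j s) + ∑ s, ∑ j, T j s ^ 2 := by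
    simp only [Finset.mul_sum, ← Finset.sum_add_distrib]
    refine Finset.sum_congr rfl fun i _ => Finset.sum_congr rfl fun j _ => ?_
    simp only [add_apply]
    ring
  have h2 : 0 ≤ ∑ s, ∑ j, T j s ^ 2 := by positivity
  linarith

variable [DecidableEq n]

/-- Cauchy-Schwarz for the form of `M`, applied to `x` and the basis vector at `s`. -/
theorem PosSemidef.mulVec_apply_sq_le {M : Matrix n n ℝ} (hM : M.PosSemidef) (x : n → ℝ) (s : n) :
    ((M *ᵥ x) s) ^ 2 ≤ (x ⬝ᵥ M *ᵥ x) * M s s := by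
  have key : ∀ t : ℝ, 0 ≤ (x ⬝ᵥ M *ᵥ x) + 2 * t * (M *ᵥ x) s + t ^ 2 * M s s := by
    intro t
    have h := hM.quadForm_nonneg (x + t • Pi.single s 1)
    have e1 : x ⬝ᵥ M.col s = (M *ᵥ x) s := by
      rw [dotProduct_comm]; exact hM.isHermitian.col_dotProduct s x
    simp only [mulVec_add, mulVec_smul, dotProduct_add, add_dotProduct, smul_dotProduct,
      dotProduct_smul, mulVec_single_one, single_dotProduct, one_mul, smul_eq_mul, col_apply,
      e1] at h
    linarith
  have := discrim_le_zero (a := M s s) (b := 2 * (M *ᵥ x) s) (c := x ⬝ᵥ M *ᵥ x)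
    (fun t => by have := key t; linarith)
  rw [discrim] at this
  linarith

theorem PosSemidef.apply_sq_le {M : Matrix n n ℝ} (hM : M.PosSemidef) (j s : n) :
    M j s ^ 2 ≤ M j j * M s s := by
  have h := hM.mulVec_apply_sq_le (Pi.single s 1) j
  simp only [mulVec_single_one, single_dotProduct, one_mul, col_apply] at h
  linarith

theorem PosSemidef.apply_eq_zero {M : Matrix n n ℝ} (hM : M.PosSemidef) {s : n} (h : M s s = 0)
    (j : n) : M j s = 0 := by
  have := hM.apply_sq_le j s
  rw [h, mul_zero] at this
  exact pow_eq_zero_iff two_ne_zero |>.1 (le_antisymm this (sq_nonneg _))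

theorem PosSemidef.sum_col_sq_le {M : Matrix n n ℝ} (hM : M.PosSemidef) (s : n) :
    ∑ j, M j s ^ 2 ≤ M.trace * M s s := by
  rw [trace, Finset.sum_mul]
  exact Finset.sum_le_sum fun j _ => hM.apply_sq_le j s

theorem PosSemidef.inv_mul_sum_col_sq_le {M : Matrix n n ℝ} (hM : M.PosSemidef) (s : n) :
    (M s s)⁻¹ * ∑ j, M j s ^ 2 ≤ M.trace := by
  rcases (hM.diag_nonneg (i := s)).eq_or_lt with h | h
  · simpa [← h] using hM.trace_nonneg
  · rw [inv_mul_le_iff₀ h, mul_comm]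
    exact hM.sum_col_sq_le s

theorem PosSemidef.pivotElim {M : Matrix n n ℝ} (hM : M.PosSemidef) (s : n) :
    (M.pivotElim s).PosSemidef := by
  refine posSemidef_real_iff.2 ⟨hM.isHermitian.pivotElim s, fun x => ?_⟩
  rw [hM.isHermitian.quadForm_pivotElim, sub_nonneg]
  rcases (hM.diag_nonneg (i := s)).eq_or_lt with h | h
  · simpa [← h] using hM.quadForm_nonneg x
  · rw [inv_mul_le_iff₀ h, mul_comm]
    exact hM.mulVec_apply_sq_le x s

/-- The Schur complement is superadditive on the positive semidefinite cone. -/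
theorem PosSemidef.pivotElim_add_sub_pivotElim {L T : Matrix n n ℝ} (hL : L.PosSemidef)
    (hT : T.PosSemidef) {s : n} (hs : 0 < L s s) :
    ((L + T).pivotElim s - L.pivotElim s).PosSemidef := by
  have hLT := hL.add hT
  refine posSemidef_real_iff.2
    ⟨(hLT.isHermitian.pivotElim s).sub (hL.isHermitian.pivotElim s), fun x => ?_⟩
  rw [sub_mulVec, dotProduct_sub, hLT.isHermitian.quadForm_pivotElim,
    hL.isHermitian.quadForm_pivotElim, add_mulVec, dotProduct_add]
  have hq := hT.mulVec_apply_sq_le x s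
  have hX := hT.quadForm_nonneg x
  have ht : 0 ≤ T s s := hT.diag_nonneg
  simp only [add_apply, Pi.add_apply]
  set p := (L *ᵥ x) s
  set q := (T *ᵥ x) s
  set X := x ⬝ᵥ T *ᵥ x
  set Y := x ⬝ᵥ L *ᵥ x
  set l := L s s
  set t := T s s
  have hlt : 0 < l + t := by linarith
  suffices h : (p + q) ^ 2 / (l + t) ≤ X + p ^ 2 / l by
    rw [div_eq_inv_mul, div_eq_inv_mul] at h
    linarith
  rw [div_le_iff₀ hlt]
  -- After multiplication by `t > 0` and use of `q² ≤ X t`, this is `(l q - t p)² ≥ 0`; if `t = 0`,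
  -- then `q = 0`.
  have hm : 0 ≤ l ^ 2 * X + t * p ^ 2 - 2 * l * p * q := by
    rcases ht.eq_or_lt with h0 | h0
    · have : q = 0 := by
        rw [← h0, mul_zero] at hq
        exact pow_eq_zero_iff two_ne_zero |>.1 (le_antisymm hq (sq_nonneg _))
      rw [this, ← h0]
      nlinarith [mul_nonneg (sq_nonneg l) hX]
    · refine nonneg_of_mul_nonneg_right (a := t) ?_ h0
      nlinarith [sq_nonneg (l * q - t * p), mul_le_mul_of_nonneg_left hq (sq_nonneg l)]
  have hid : (X + p ^ 2 / l) * (l + t) - (p + q) ^ 2 =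
      (X * t - q ^ 2) + (l ^ 2 * X + t * p ^ 2 - 2 * l * p * q) / l := by
    field_simp
    ring
  have := div_nonneg hm hs.le
  linarith

/-- The kernel grows strictly: it keeps `ker M` and gains the basis vector at `s`. -/
theorem rank_pivotElim_lt {M : Matrix n n ℝ} (hM : M.IsHermitian) {s : n} (hs : M s s ≠ 0) :
    (M.pivotElim s).rank < M.rank := by
  have hlt : LinearMap.ker M.mulVecLin < LinearMap.ker (M.pivotElim s).mulVecLin := by
    refine lt_of_le_of_ne (fun x hx => ?_) fun h => ?_
    · rw [LinearMap.mem_ker, mulVecLin_apply] at hx ⊢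
      rw [pivotElim, sub_mulVec, hx, smul_mulVec, vecMulVec_mulVec, hM.col_dotProduct, hx]
      simp
    · have hmem : (Pi.single s 1 : n → ℝ) ∈ LinearMap.ker M.mulVecLin := by
        rw [h, LinearMap.mem_ker, mulVecLin_apply, mulVec_single_one]
        ext j
        simp only [pivotElim, col_apply, sub_apply, smul_apply, vecMulVec_apply, smul_eq_mul,
          Pi.zero_apply]
        field_simp
        simp
      rw [LinearMap.mem_ker, mulVecLin_apply, mulVec_single_one] at hmem
      exact hs (congrFun hmem s)
  have h1 := Submodule.finrank_lt_finrank_of_lt hlt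
  have h2 := M.mulVecLin.finrank_range_add_finrank_ker
  have h3 := (M.pivotElim s).mulVecLin.finrank_range_add_finrank_ker
  rw [rank, rank]
  omega

theorem PosSemidef.eq_zero_of_diag {M : Matrix n n ℝ} (hM : M.PosSemidef)
    (h : ∀ s, M s s = 0) : M = 0 := by
  ext j s
  exact hM.apply_eq_zero (h s) j

/-- Splitting off one pivot from a positive semidefinite matrix `L + T` lowers the rank of the part
`L` by one, at the cost of a controlled growth of the remainder `T`. -/
theorem PosSemidef.exists_pivotElim_add {L T : Matrix n n ℝ} (hL : L.PosSemidef)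
    (hT : T.PosSemidef) {m : ℕ} (hr : L.rank ≤ m + 1) (s : n) (hs : 0 < (L + T) s s) :
    ∃ L' T' : Matrix n n ℝ, L'.PosSemidef ∧ T'.PosSemidef ∧ L'.rank ≤ m ∧
      (L + T).pivotElim s = L' + T' ∧
      T'.trace ≤ T.trace +
        (T s s * L.trace + ∑ j, L j s ^ 2 - ∑ j, (L + T) j s ^ 2) / (L + T) s s := by
  have ht : 0 ≤ T s s := hT.diag_nonneg
  rcases (hL.diag_nonneg (i := s)).eq_or_lt with h0 | h0
  -- Here the pivot does not touch `L`, so its rank must be lowered otherwise: a rank-one piece at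
  -- another pivot `q` moves from `L` to the remainder. This costs at most `tr L`, exactly what the
  -- bound allows.
  · have hcol : ∀ j, L j s = 0 := hL.apply_eq_zero h0.symm
    have hT0 : T s s ≠ 0 := by
      intro h
      simp [← h0, h] at hs
    have hE : (L + T).pivotElim s = L + T.pivotElim s := by
      ext i j
      simp [Matrix.pivotElim, vecMulVec_apply, hcol]
      ring
    have htr : T.trace + (T s s * L.trace + ∑ j, L j s ^ 2 - ∑ j, (L + T) j s ^ 2) / (L + T) s s
        = (T.pivotElim s).trace + L.trace := by
      rw [trace_pivotElim]
      simp only [add_apply, hcol, zero_add]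
      field_simp
      simp
      ring
    rw [htr, hE]
    by_cases hz : ∃ q, L q q ≠ 0
    · obtain ⟨q, hq⟩ := hz
      have hq' : 0 < L q q := lt_of_le_of_ne hL.diag_nonneg hq.symm
      have hV : (L - L.pivotElim q).PosSemidef := by
        have := (posSemidef_vecMulVec_self_star (R := ℝ) (fun j => L j q)).smul (inv_nonneg.2 hq'.le)
        simpa [Matrix.pivotElim] using this
      refine ⟨L.pivotElim q, T.pivotElim s + (L - L.pivotElim q), hL.pivotElim q,
        (hT.pivotElim s).add hV, ?_, by abel, ?_⟩
      · have := rank_pivotElim_lt hL.isHermitian hq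
        omega
      · rw [trace_add, trace_sub]
        have := (hL.pivotElim q).trace_nonneg
        linarith
    · push Not at hz
      refine ⟨0, T.pivotElim s, .zero, hT.pivotElim s, by simp, ?_, ?_⟩
      · rw [hL.eq_zero_of_diag hz]
      · rw [hL.eq_zero_of_diag hz]; simp
  · refine ⟨L.pivotElim s, (L + T).pivotElim s - L.pivotElim s, hL.pivotElim s,
      hL.pivotElim_add_sub_pivotElim hT h0, ?_, by abel, ?_⟩
    · have := rank_pivotElim_lt hL.isHermitian h0.ne'
      omega
    · rw [trace_sub, trace_pivotElim, trace_pivotElim, trace_add]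
      have : (L s s)⁻¹ * ∑ j, L j s ^ 2 ≤ (T s s * L.trace + ∑ j, L j s ^ 2) / (L + T) s s := by
        rw [le_div_iff₀ hs, add_apply, mul_add, mul_assoc, mul_comm _ (L s s),
          inv_mul_cancel_left₀ h0.ne']
        have := mul_le_mul_of_nonneg_left (hL.inv_mul_sum_col_sq_le s) ht
        linarith
      rw [sub_div, ← div_eq_inv_mul (∑ j, (L + T) j s ^ 2)]
      linarith

end Matrix

/-! ### Trace inequalities for orthogonal projectors. -/

namespace Matrix

variable {n : Type*} [Fintype n]

theorem trace_mul_mul_self_nonneg {m : Type*} [Fintype m] {P : Matrix n n ℝ}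
    (hP : P.IsHermitian) (hPP : P * P = P) (B : Matrix n m ℝ) : 0 ≤ (P * (B * Bᵀ)).trace := by
  have h : (P * (B * Bᵀ)).trace = ((P * B) * (P * B)ᴴ).trace := by
    rw [conjTranspose_mul, hP.eq, ← Matrix.mul_assoc (P * B), trace_mul_comm _ P,
      ← Matrix.mul_assoc, ← Matrix.mul_assoc, ← Matrix.mul_assoc P P B, hPP,
      conjTranspose_eq_transpose_of_trivial]
  rw [h]
  exact (posSemidef_self_mul_conjTranspose (P * B)).trace_nonneg

theorem posSemidef_of_isHermitian_of_mul_self {P : Matrix n n ℝ}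
    (hP : P.IsHermitian) (hPP : P * P = P) : P.PosSemidef := by
  have := posSemidef_self_mul_conjTranspose P
  rwa [hP.eq, hPP] at this

/-- The Cauchy-Schwarz inequality for the Frobenius inner product with an orthogonal projector. -/
theorem trace_projector_mul_sq_le {P M : Matrix n n ℝ} (hP : P.IsHermitian)
    (hPP : P * P = P) (hM : M.IsHermitian) :
    (P * M).trace ^ 2 ≤ P.trace * (P * (M * M)).trace := by
  -- Inserting `P = P P` gives `tr (P M) = ⟨P, P M⟩`, so that `P` appears in both Frobenius norms.
  have e1 : (P * M).trace = ∑ ij : n × n, P ij.1 ij.2 * (P * M) ij.1 ij.2 := by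
    rw [Fintype.sum_prod_type]
    conv_lhs => rw [← hPP, mul_assoc, trace]
    rw [Finset.sum_comm]
    refine Finset.sum_congr rfl fun i _ => ?_
    rw [diag_apply, mul_apply]
    refine Finset.sum_congr rfl fun j _ => ?_
    rw [show P j i = P i j by simpa using hP.apply i j]
  have e2 : ∀ B : Matrix n n ℝ, ∑ ij : n × n, B ij.1 ij.2 ^ 2 = (B * Bᴴ).trace := by
    intro B
    rw [Fintype.sum_prod_type, trace]
    simp [mul_apply, sq]
  have e3 : ((P * M) * (P * M)ᴴ).trace = (P * (M * M)).trace := by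
    rw [conjTranspose_mul, hP.eq, hM.eq, ← mul_assoc (P * M), trace_mul_comm _ P, ← mul_assoc,
      ← mul_assoc, hPP, mul_assoc]
  rw [e1]
  refine (Finset.sum_mul_sq_le_sq_mul_sq _ _ _).trans ?_
  rw [e2 P, e2 (P * M), e3, hP.eq, hPP]

end Matrix

/-! ### The spectral truncation and its projector. -/

/-- The position of the `i`-th eigenvalue in the decreasing list of the eigenvalues. -/
noncomputable def eigPosition (N : ℕ) : Fin N ≃ Fin (Fintype.card (Fin N)) :=
  (Fintype.equivOfCardEq (Fintype.card_fin _)).symm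

/-- The orthogonal projector onto the span of the eigenvectors of the `r` largest eigenvalues. -/
noncomputable def topProjector {N : ℕ} {A : Matrix (Fin N) (Fin N) ℝ} (hA : A.IsHermitian)
    (r : ℕ) : Matrix (Fin N) (Fin N) ℝ :=
  hA.eigenvectorUnitary.1 * diagonal (fun i => if (eigPosition N i).val < r then 1 else 0) *
    hA.eigenvectorUnitary.1ᴴ

section truncEig

variable {N : ℕ} {A : Matrix (Fin N) (Fin N) ℝ} (hA : A.IsHermitian) (r : ℕ)

theorem isHermitian_topProjector : (topProjector hA r).IsHermitian := by
  refine isHermitian_mul_mul_conjTranspose _ ?_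
  simp [IsHermitian]

theorem Matrix.IsHermitian.conjTranspose_eigenvectorUnitary_mul_self :
    hA.eigenvectorUnitary.1ᴴ * hA.eigenvectorUnitary.1 = 1 :=
  Unitary.coe_star_mul_self hA.eigenvectorUnitary

theorem Matrix.IsHermitian.eigenvectorUnitary_conj_mul (d e : Fin N → ℝ) :
    (hA.eigenvectorUnitary.1 * diagonal d * hA.eigenvectorUnitary.1ᴴ) *
      (hA.eigenvectorUnitary.1 * diagonal e * hA.eigenvectorUnitary.1ᴴ) =
    hA.eigenvectorUnitary.1 * diagonal (fun i => d i * e i) * hA.eigenvectorUnitary.1ᴴ := by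
  have h := hA.conjTranspose_eigenvectorUnitary_mul_self
  set U := hA.eigenvectorUnitary.1
  calc _ = U * diagonal d * (Uᴴ * U) * diagonal e * Uᴴ := by simp only [mul_assoc]
    _ = _ := by rw [h, mul_one, mul_assoc U, diagonal_mul_diagonal]

theorem topProjector_mul_self : topProjector hA r * topProjector hA r = topProjector hA r := by
  rw [topProjector, hA.eigenvectorUnitary_conj_mul]
  simp only [mul_ite, mul_one, mul_zero]
  congr! 4
  split_ifs <;> rfl

theorem Matrix.IsHermitian.eq_eigenvectorUnitary_conj :
    A = hA.eigenvectorUnitary.1 * diagonal hA.eigenvalues * hA.eigenvectorUnitary.1ᴴ := by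
  conv_lhs => rw [hA.spectral_theorem]
  rfl

theorem truncEig_eq_conj : truncEig hA r = hA.eigenvectorUnitary.1 * diagonal (fun i =>
    if (eigPosition N i).val < r then hA.eigenvalues i else 0) *
      hA.eigenvectorUnitary.1ᴴ := by
  rw [truncEig, ← Equiv.sum_comp (eigPosition N)]
  ext i j
  rw [Matrix.sum_apply, mul_apply]
  refine Finset.sum_congr rfl fun k _ => ?_
  rw [mul_diagonal]
  split_ifs
  · simp [vecMulVec_apply, IsHermitian.eigenvalues, eigPosition]
    ring
  · simp

theorem topProjector_mul_eq_truncEig : topProjector hA r * A = truncEig hA r := by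
  conv_lhs => enter [2]; rw [hA.eq_eigenvectorUnitary_conj]
  rw [topProjector, hA.eigenvectorUnitary_conj_mul, truncEig_eq_conj]
  simp

theorem trace_topProjector_le : (topProjector hA r).trace ≤ r := by
  rw [topProjector, trace_mul_comm, ← mul_assoc, hA.conjTranspose_eigenvectorUnitary_mul_self,
    one_mul, trace_diagonal, Equiv.sum_comp (eigPosition N)
    (fun j => if j.val < r then (1 : ℝ) else 0)]
  rw [Finset.sum_boole]
  exact_mod_cast (Fin.card_filter_val_lt ..).trans_le (min_le_right _ _)

theorem rank_truncEig_le : (truncEig hA r).rank ≤ r := by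
  rw [truncEig_eq_conj]
  refine (rank_mul_le_left _ _).trans ((rank_mul_le_right _ _).trans ?_)
  rw [rank_diagonal]
  rw [Fintype.card_subtype]
  calc _ ≤ (Finset.univ.filter fun i => (eigPosition N i).val < r).card := by
        refine Finset.card_le_card fun i hi => ?_
        simp only [Finset.mem_filter, Finset.mem_univ, true_and] at hi ⊢
        by_contra h
        simp [h] at hi
    _ ≤ (Finset.range r).card := by
        refine Finset.card_le_card_of_injOn (fun i => (eigPosition N i).val) (by simp [Set.MapsTo]) ?_
        exact fun i _ j _ h => (eigPosition N).injective (Fin.ext h)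
    _ = r := Finset.card_range r

theorem posSemidef_truncEig (hp : A.PosSemidef) : (truncEig hp.isHermitian r).PosSemidef := by
  rw [truncEig_eq_conj]
  refine PosSemidef.mul_mul_conjTranspose_same (PosSemidef.diagonal fun i => ?_) _
  dsimp only
  split_ifs
  · exact hp.eigenvalues_nonneg i
  · exact le_rfl

theorem posSemidef_sub_truncEig (hp : A.PosSemidef) :
    (A - truncEig hp.isHermitian r).PosSemidef := by
  conv => enter [1, 1]; rw [hp.isHermitian.eq_eigenvectorUnitary_conj]
  rw [truncEig_eq_conj, ← sub_mul, ← mul_sub, diagonal_sub]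
  refine PosSemidef.mul_mul_conjTranspose_same (PosSemidef.diagonal fun i => ?_) _
  dsimp only
  have := hp.eigenvalues_nonneg i
  split_ifs <;> simp [this]

end truncEig

/-! ### Expectations in `ℝ≥0∞` under discrete distributions. -/

namespace PMF

variable {α β : Type*}

/-- The expectation of an extended nonnegative function under a discrete distribution. -/
noncomputable def expect (p : PMF α) (f : α → ℝ≥0∞) : ℝ≥0∞ := ∑' x, p x * f x

theorem expect_pure (a : α) (f : α → ℝ≥0∞) : (PMF.pure a).expect f = f a := by
  classical
  rw [expect, tsum_eq_single a (fun x hx => by simp [PMF.pure_apply, hx])]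
  simp

theorem expect_bind (p : PMF α) (q : α → PMF β) (f : β → ℝ≥0∞) :
    (p.bind q).expect f = p.expect fun a => (q a).expect f := by
  simp only [expect, PMF.bind_apply, ← ENNReal.tsum_mul_right, ← ENNReal.tsum_mul_left]
  rw [ENNReal.tsum_comm]
  simp only [mul_assoc]

theorem expect_map (p : PMF α) (g : α → β) (f : β → ℝ≥0∞) :
    (p.map g).expect f = p.expect (f ∘ g) := by
  rw [← PMF.bind_pure_comp, expect_bind]
  simp only [Function.comp_def, expect_pure]

theorem expect_mono {p : PMF α} {f g : α → ℝ≥0∞} (h : ∀ x ∈ p.support, f x ≤ g x) :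
    p.expect f ≤ p.expect g := by
  refine ENNReal.tsum_le_tsum fun x => ?_
  by_cases hx : p x = 0
  · simp [hx]
  · gcongr
    exact h x ((p.mem_support_iff x).2 hx)

theorem expect_const (p : PMF α) (c : ℝ≥0∞) : p.expect (fun _ => c) = c := by
  rw [expect, ENNReal.tsum_mul_right, p.tsum_coe, one_mul]

theorem expect_add (p : PMF α) (f g : α → ℝ≥0∞) :
    p.expect (fun x => f x + g x) = p.expect f + p.expect g := by
  simp only [expect, mul_add, ENNReal.tsum_add]

theorem expect_const_mul (p : PMF α) (c : ℝ≥0∞) (f : α → ℝ≥0∞) :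
    p.expect (fun x => c * f x) = c * p.expect f := by
  simp only [expect, ← ENNReal.tsum_mul_left]
  exact tsum_congr fun x => by ring

/-- The measure is a sum of weighted point masses, even on an uncountable type such as the type of
states. -/
theorem lintegral_toMeasure [MeasurableSpace α] [MeasurableSingletonClass α] (p : PMF α)
    (f : α → ℝ≥0∞) : ∫⁻ x, f x ∂p.toMeasure = p.expect f := by
  have : p.toMeasure = MeasureTheory.Measure.sum fun x => p x • MeasureTheory.Measure.dirac x := by
    ext s hs
    rw [PMF.toMeasure_apply _ hs, MeasureTheory.Measure.sum_apply _ hs]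
    refine tsum_congr fun x => ?_
    by_cases hx : x ∈ s <;> simp [hx, hs]
  rw [this, MeasureTheory.lintegral_sum_measure, expect]
  simp [MeasureTheory.lintegral_smul_measure]

theorem ae_toMeasure_of_support [MeasurableSpace α] [MeasurableSingletonClass α] {p : PMF α}
    {P : α → Prop} (h : ∀ x ∈ p.support, P x) : ∀ᵐ x ∂p.toMeasure, P x := by
  rw [MeasureTheory.ae_iff, PMF.toMeasure_apply_eq_toOuterMeasure,
    PMF.toOuterMeasure_apply_eq_zero_iff, Set.disjoint_left]
  exact fun x hx hn => hn (h x hx)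

end PMF

/-! ### The scalar recursion for the head. -/

section Recursion

/-- The majorant `x ↦ x - x² / (r (x + b))` of the expected decrease of the head of the residual in
one iteration. -/
noncomputable def headStep (r b x : ℝ) : ℝ := x - x ^ 2 / (r * (x + b))

variable {r b : ℝ}

theorem headStep_zero : headStep r b 0 = 0 := by simp [headStep]

theorem headStep_nonneg (hr : 1 ≤ r) (hb : 0 ≤ b) {x : ℝ} (hx : 0 ≤ x) :
    0 ≤ headStep r b x := by
  rcases hx.eq_or_lt with rfl | hx'
  · simp [headStep_zero]
  rw [headStep, sub_nonneg, div_le_iff₀ (by positivity)]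
  nlinarith [mul_nonneg hx hb, mul_nonneg (sub_nonneg.2 hr) (mul_nonneg hx (add_nonneg hx hb))]

theorem headStep_le (hr : 0 ≤ r) (hb : 0 ≤ b) {x : ℝ} (hx : 0 ≤ x) : headStep r b x ≤ x := by
  have : 0 ≤ x ^ 2 / (r * (x + b)) := by positivity
  rw [headStep]
  linarith

/-- `headStep r b` is concave, increasing, and zero at zero, so that it lies below affine functions
with nonnegative coefficients that touch it at a given point. -/
theorem exists_affine_headStep (hr : 1 ≤ r) (hb : 0 ≤ b) {a : ℝ} (ha : 0 ≤ a) :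
    ∃ c d : ℝ, 0 ≤ c ∧ 0 ≤ d ∧ c * a + d = headStep r b a ∧
      ∀ x, 0 ≤ x → headStep r b x ≤ c * x + d := by
  have hr0 : 0 < r := by linarith
  rcases (add_nonneg ha hb).eq_or_lt with h0 | h0
  · obtain rfl : a = 0 := by linarith
    obtain rfl : b = 0 := by linarith
    exact ⟨1, 0, zero_le_one, le_rfl, by simp [headStep_zero], fun x hx => by
      simpa using headStep_le hr0.le le_rfl hx⟩
  -- Slope and intercept of the tangent at `a`.
  · refine ⟨1 - 1 / r + b ^ 2 / (r * (a + b) ^ 2), b * a ^ 2 / (r * (a + b) ^ 2), ?_, by positivity,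
      ?_, ?_⟩
    · have : 1 / r ≤ 1 := by rw [div_le_one hr0]; exact hr
      have : 0 ≤ b ^ 2 / (r * (a + b) ^ 2) := by positivity
      linarith
    · rw [headStep]
      field_simp
      ring
    · intro x hx
      rcases hx.eq_or_lt with rfl | hx'
      · rw [headStep_zero, mul_zero, zero_add]; positivity
      have hxb : 0 < x + b := by linarith
      have : (1 - 1 / r + b ^ 2 / (r * (a + b) ^ 2)) * x + b * a ^ 2 / (r * (a + b) ^ 2) -
          headStep r b x = b ^ 2 * (x - a) ^ 2 / (r * (a + b) ^ 2 * (x + b)) := by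
        rw [headStep]
        field_simp
        ring
      have : 0 ≤ b ^ 2 * (x - a) ^ 2 / (r * (a + b) ^ 2 * (x + b)) := by positivity
      linarith

theorem iterate_headStep_nonneg (hr : 1 ≤ r) (hb : 0 ≤ b) {a : ℝ} (ha : 0 ≤ a) (j : ℕ) :
    0 ≤ (headStep r b)^[j] a := by
  induction j with
  | zero => exact ha
  | succ j ih => rw [Function.iterate_succ_apply']; exact headStep_nonneg hr hb ih

/-- Along the recursion, `log x - b / x` decreases by at least `1 / r` in each step. -/
theorem headStep_potential (hr : 1 ≤ r) (hb : 0 ≤ b) {x : ℝ} (hx : 0 < x)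
    (hy : 0 < headStep r b x) :
    1 / r ≤ (Real.log x - b / x) - (Real.log (headStep r b x) - b / headStep r b x) := by
  have hr0 : 0 < r := by linarith
  set y := headStep r b x with hyd
  have hyx : y ≤ x := headStep_le hr0.le hb hx.le
  have hlog := Real.log_le_sub_one_of_pos (div_pos hy hx)
  rw [Real.log_div hy.ne' hx.ne'] at hlog
  have h1 : b / y - b / x ≥ b * (x - y) / x ^ 2 := by
    rw [div_sub_div _ _ hy.ne' hx.ne', ge_iff_le, div_le_div_iff₀ (by positivity) (by positivity)]
    have : 0 ≤ b * (x - y) * x * (x - y) := by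
      have := sub_nonneg.2 hyx
      positivity
    nlinarith
  -- The potential is an antiderivative of `(x + b) / x²`, the reciprocal of the decrement up to the
  -- factor `r`; hence the exact value `1 / r`.
  have h2 : (1 - y / x) + b * (x - y) / x ^ 2 = 1 / r := by
    have : x - y = x ^ 2 / (r * (x + b)) := by rw [hyd, headStep]; ring
    rw [one_sub_div hx.ne', this]
    have : 0 < x + b := by linarith
    field_simp
  linarith

/-- While the iterates exceed `ε b`, the potential `log x - b / x` stays above `log (ε b) - 1 / ε`.
It starts at most at `log (c b)` and loses `1 / r` per step, which limits the number of steps. -/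
theorem iterate_headStep_le (hr : 1 ≤ r) (hb : 0 ≤ b) {a c ε : ℝ} (hε : 0 < ε) (ha : 0 ≤ a)
    (hac : a ≤ c * b) (j : ℕ) (hj : r / ε + r * max (Real.log (c / ε)) 0 ≤ j) :
    (headStep r b)^[j] a ≤ ε * b := by
  have hr0 : 0 < r := by linarith
  rcases hb.eq_or_lt with rfl | hb0
  · obtain rfl : a = 0 := le_antisymm (by simpa using hac) ha
    rw [mul_zero, Function.iterate_fixed headStep_zero]
  by_contra! hlt
  have hmono : ∀ i, i ≤ j → ε * b < (headStep r b)^[i] a := by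
    intro i hi
    refine hlt.trans_le (antitone_nat_of_succ_le (f := fun i => (headStep r b)^[i] a) (fun i => ?_) hi)
    rw [Function.iterate_succ_apply']
    exact headStep_le hr0.le hb (iterate_headStep_nonneg hr hb ha i)
  have heb : 0 < ε * b := by positivity
  have hpot : ∀ i, i ≤ j → i / r ≤ (Real.log a - b / a) -
      (Real.log ((headStep r b)^[i] a) - b / (headStep r b)^[i] a) := by
    intro i
    induction i with
    | zero => simp
    | succ i ih =>
      intro hi
      have h1 := ih (by omega)
      have h2 := hmono i (by omega)
      have h3 := hmono (i + 1) hi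
      rw [Function.iterate_succ_apply'] at h3 ⊢
      have := headStep_potential hr hb (heb.trans h2) (heb.trans h3)
      push_cast
      rw [add_div]
      linarith
  have h := hpot j le_rfl
  have ha0 : ε * b < a := hmono 0 (Nat.zero_le _)
  have hapos : 0 < a := heb.trans ha0
  set y := (headStep r b)^[j] a
  have h1 : b / y < 1 / ε := by
    rw [div_lt_div_iff₀ (heb.trans hlt) hε]
    linarith
  have h2 : 0 ≤ b / a := by positivity
  have h3 : Real.log (ε * b) ≤ Real.log y := Real.log_le_log heb hlt.le
  have hc : 0 < c := by
    by_contra! hc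
    nlinarith
  have h4 : Real.log a ≤ Real.log (c / ε) + Real.log (ε * b) := by
    rw [← Real.log_mul (by positivity) (by positivity)]
    refine Real.log_le_log hapos ?_
    have : c / ε * (ε * b) = c * b := by field_simp
    rw [this]; exact hac
  have h5 := le_max_left (Real.log (c / ε)) 0
  have h6 : 1 / ε + max (Real.log (c / ε)) 0 ≤ j / r := by
    rw [le_div_iff₀ hr0]
    calc _ = r / ε + r * max (Real.log (c / ε)) 0 := by ring
      _ ≤ j := hj
  linarith

end Recursion

/-! ### The loop invariant and one random iteration. -/

namespace RPCState

variable {N i : ℕ}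

/-- The residual `A - F Fᵀ`. -/
noncomputable def residual (A : Matrix (Fin N) (Fin N) ℝ) (st : RPCState N i) :
    Matrix (Fin N) (Fin N) ℝ :=
  A - st.approx

/-- The loop invariant: the residual is positive semidefinite and `d` is its diagonal. -/
structure Valid (A : Matrix (Fin N) (Fin N) ℝ) (st : RPCState N i) : Prop where
  posSemidef : (st.residual A).PosSemidef
  diag : st.d = (st.residual A).diag

theorem snoc_mul_transpose (F : Matrix (Fin N) (Fin i) ℝ) (f : Fin N → ℝ) :
    (Matrix.of fun j => Fin.snoc (α := fun _ => ℝ) (F j) (f j) : Matrix (Fin N) (Fin (i + 1)) ℝ) *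
      (Matrix.of fun j => Fin.snoc (α := fun _ => ℝ) (F j) (f j)).transpose =
    F * F.transpose + vecMulVec f f := by
  ext a b
  simp [mul_apply, Fin.sum_univ_castSucc, vecMulVec_apply]

theorem residual_init (A : Matrix (Fin N) (Fin N) ℝ) : (init A).residual A = A := by
  simp [residual, approx, init]

theorem residual_idle (A : Matrix (Fin N) (Fin N) ℝ) (st : RPCState N i) :
    st.idle.residual A = st.residual A := by
  rw [residual, residual, approx, idle, snoc_mul_transpose st.F fun _ => 0, approx]
  congr 1
  ext a b
  simp [vecMulVec_apply]

theorem residual_apply (A : Matrix (Fin N) (Fin N) ℝ) (st : RPCState N i) (j s : Fin N) :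
    A j s - st.F.mulVec (st.F s) j = st.residual A j s := by
  simp [residual, approx, mul_apply, mulVec, dotProduct]

/-- A zero pivot is covered too: division by `√0` gives a zero column, in accordance with `0⁻¹ = 0`
in `pivotElim`. -/
theorem residual_update {A : Matrix (Fin N) (Fin N) ℝ} {st : RPCState N i}
    {s : Fin N} (hs : 0 ≤ st.residual A s s) :
    (st.update A s).residual A = (st.residual A).pivotElim s := by
  rw [residual, approx, update]
  simp only
  rw [snoc_mul_transpose st.F fun j =>
    (A j s - st.F.mulVec (st.F s) j) / √(A s s - st.F.mulVec (st.F s) s)]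
  simp only [residual_apply, pivotElim]
  rw [← sub_sub]
  congr 1
  ext a b
  simp only [vecMulVec_apply, Matrix.smul_apply, smul_eq_mul]
  rw [div_mul_div_comm, Real.mul_self_sqrt hs, div_eq_inv_mul]

theorem valid_init {A : Matrix (Fin N) (Fin N) ℝ} (hA : A.PosSemidef) : (init A).Valid A :=
  ⟨by rwa [residual_init], by rw [residual_init]; rfl⟩

theorem Valid.idle {A : Matrix (Fin N) (Fin N) ℝ} {st : RPCState N i} (h : st.Valid A) :
    st.idle.Valid A :=
  ⟨by rw [residual_idle]; exact h.posSemidef, by rw [residual_idle]; exact h.diag⟩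

theorem Valid.update {A : Matrix (Fin N) (Fin N) ℝ} {st : RPCState N i} (h : st.Valid A)
    (s : Fin N) : (st.update A s).Valid A := by
  have hs : 0 ≤ st.residual A s s := h.posSemidef.diag_nonneg
  refine ⟨by rw [residual_update hs]; exact h.posSemidef.pivotElim s, ?_⟩
  rw [residual_update hs]
  ext j
  simp only [RPCState.update, residual_apply, h.diag, diag_apply, pivotElim, Matrix.sub_apply,
    Matrix.smul_apply, vecMulVec_apply, smul_eq_mul]
  rw [sq_abs, div_pow, Real.sq_sqrt hs, div_eq_inv_mul, sq]

theorem trace_residual_eq {A : Matrix (Fin N) (Fin N) ℝ} {st : RPCState N i} (h : st.Valid A) :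
    ∑' j, ENNReal.ofReal (st.d j) = ENNReal.ofReal (st.residual A).trace := by
  rw [tsum_fintype, h.diag, trace, ENNReal.ofReal_sum_of_nonneg]
  exact fun j _ => h.posSemidef.diag_nonneg

theorem Valid.of_mem_support_step {A : Matrix (Fin N) (Fin N) ℝ} {st : RPCState N i}
    (h : st.Valid A) {st' : RPCState N (i + 1)} (hs : st' ∈ (st.step A).support) :
    st'.Valid A := by
  rw [step] at hs
  split_ifs at hs
  · rw [PMF.support_pure, Set.mem_singleton_iff] at hs
    exact hs ▸ h.idle
  · rw [PMF.support_map] at hs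
    obtain ⟨s, -, rfl⟩ := hs
    exact h.update s

theorem expect_step_of_trace_eq_zero {A : Matrix (Fin N) (Fin N) ℝ} {st : RPCState N i}
    (h : st.Valid A) (h0 : (st.residual A).trace = 0) (f : RPCState N (i + 1) → ℝ≥0∞) :
    (st.step A).expect f = f st.idle := by
  rw [step, dif_pos (by rw [trace_residual_eq h, h0, ENNReal.ofReal_zero]), PMF.expect_pure]

/-- Pivots with zero diagonal entry have probability zero, so `c` is constrained only at the others.
-/
theorem expect_step_le {A : Matrix (Fin N) (Fin N) ℝ} {st : RPCState N i}
    (h : st.Valid A) (h0 : 0 < (st.residual A).trace) {f : RPCState N (i + 1) → ℝ≥0∞}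
    {c : Fin N → ℝ} (hc : ∀ s, 0 < st.residual A s s → 0 ≤ c s ∧
      f (st.update A s) ≤ ENNReal.ofReal (c s)) :
    (st.step A).expect f ≤
      ENNReal.ofReal ((∑ s, st.residual A s s * c s) / (st.residual A).trace) := by
  have hd : ∀ s, 0 ≤ st.residual A s s := fun s => h.posSemidef.diag_nonneg
  rw [step, dif_neg (by rw [trace_residual_eq h]; simpa using h0), PMF.expect_map, PMF.expect,
    tsum_fintype, Finset.sum_div, ENNReal.ofReal_sum_of_nonneg]
  · refine Finset.sum_le_sum fun s _ => ?_
    rw [PMF.normalize_apply, trace_residual_eq h, ← ENNReal.ofReal_inv_of_pos h0, h.diag,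
      diag_apply]
    rcases (hd s).eq_or_lt with hs | hs
    · simp [← hs]
    · calc _ ≤ ENNReal.ofReal (st.residual A s s) * ENNReal.ofReal ((st.residual A).trace)⁻¹ *
            ENNReal.ofReal (c s) := by gcongr; exact (hc s hs).2
        _ = _ := by
          rw [← ENNReal.ofReal_mul (hd s), ← ENNReal.ofReal_mul (by positivity)]
          congr 1
          ring
  · intro s _
    rcases (hd s).eq_or_lt with hs | hs
    · simp [← hs]
    · have := (hc s hs).1
      positivity

/-! ### Expected decrease of the head. -/

section Head

variable {P A : Matrix (Fin N) (Fin N) ℝ} {st : RPCState N i}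

theorem trace_projector_residual_le (hP : P.IsHermitian) (hPP : P * P = P) :
    (P * st.residual A).trace ≤ (P * A).trace := by
  rw [residual, mul_sub, trace_sub, sub_le_self_iff]
  exact trace_mul_mul_self_nonneg hP hPP st.F

theorem trace_mul_pivotElim (P : Matrix (Fin N) (Fin N) ℝ) {M : Matrix (Fin N) (Fin N) ℝ}
    (hM : M.IsHermitian) (s : Fin N) :
    (P * M.pivotElim s).trace = (P * M).trace - (M s s)⁻¹ * (M * P * M) s s := by
  have : (P * vecMulVec (fun j => M j s) (fun j => M j s)).trace = (M * P * M) s s := by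
    rw [mul_vecMulVec, trace_vecMulVec, dotProduct_comm, hM.col_dotProduct, mulVec_mulVec]
    rfl
  rw [pivotElim, mul_sub, trace_sub, Matrix.mul_smul, trace_smul, this, smul_eq_mul]

/-- The expected new head is `tr (P R) - tr (P R²) / tr R`; Cauchy-Schwarz bounds the numerator
below and `hb` bounds the denominator above. -/
theorem expect_step_head_le {r : ℕ} {b : ℝ} (hP : P.IsHermitian) (hPP : P * P = P)
    (hr : P.trace ≤ r) (h : st.Valid A)
    (hb : (st.residual A).trace ≤ (P * st.residual A).trace + b) :
    (st.step A).expect (fun st' => ENNReal.ofReal (P * st'.residual A).trace) ≤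
      ENNReal.ofReal (headStep r b (P * st.residual A).trace) := by
  have hPpos := posSemidef_of_isHermitian_of_mul_self hP hPP
  have hh := hPpos.trace_mul_nonneg h.posSemidef
  rcases h.posSemidef.trace_nonneg.eq_or_lt with h0 | h0
  · rw [expect_step_of_trace_eq_zero h h0.symm, residual_idle]
    have hz : st.residual A = 0 := h.posSemidef.trace_eq_zero_iff.1 h0.symm
    simp [hz, headStep_zero]
  · set R := st.residual A with hR
    have hRh : R.IsHermitian := h.posSemidef.isHermitian
    refine (expect_step_le h h0 (c := fun s => (P * R.pivotElim s).trace) fun s hs =>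
      ⟨hPpos.trace_mul_nonneg (h.posSemidef.pivotElim s), ?_⟩).trans ?_
    · rw [residual_update hs.le]
    · refine ENNReal.ofReal_le_ofReal ?_
      have hsum : ∑ s, R s s * (P * R.pivotElim s).trace =
          R.trace * (P * R).trace - (P * (R * R)).trace := by
        have e : (P * (R * R)).trace = ∑ s, (R * P * R) s s := by
          rw [← mul_assoc, trace_mul_comm, ← mul_assoc]
          rfl
        rw [e, trace, Finset.sum_mul, ← Finset.sum_sub_distrib]
        refine Finset.sum_congr rfl fun s _ => ?_
        rw [trace_mul_pivotElim P hRh, diag_apply]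
        rcases eq_or_ne (R s s) 0 with hs | hs
        · have : (R * P * R) s s = 0 := by
            rw [mul_apply]
            exact Finset.sum_eq_zero fun j _ => by
              rw [show R j s = 0 from h.posSemidef.apply_eq_zero hs j, mul_zero]
          rw [this, hs]
          simp
        · field_simp
      rw [← hR, hsum, headStep, sub_div, mul_div_cancel_left₀ _ h0.ne']
      have hCS := trace_projector_mul_sq_le hP hPP hRh
      have hRR : 0 ≤ (P * (R * R)).trace := by
        have := trace_mul_mul_self_nonneg hP hPP R
        rwa [show Rᵀ = R by simpa using hRh.eq] at this
      refine sub_le_sub_left ?_ _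
      rcases (Nat.cast_nonneg (α := ℝ) r).eq_or_lt with hr0 | hr0
      · rw [← hr0, zero_mul, div_zero]
        positivity
      · have hcs := hCS.trans (mul_le_mul_of_nonneg_right hr hRR)
        calc _ ≤ (P * R).trace ^ 2 / (r * R.trace) := by gcongr
          _ ≤ _ := by
            rw [div_le_div_iff₀ (by positivity) h0]
            nlinarith [mul_le_mul_of_nonneg_right hcs h0.le]

end Head

/-! ### Expected growth of the remainder when the rank drops. -/

section Doubling

/-- The smallest trace of the remainder when the part of rank at most `m` is split off from `M`. -/
noncomputable def _root_.Matrix.psdTail (M : Matrix (Fin N) (Fin N) ℝ) (m : ℕ) : ℝ≥0∞ :=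
  ⨅ (L : Matrix (Fin N) (Fin N) ℝ) (T : Matrix (Fin N) (Fin N) ℝ) (_ : L.PosSemidef ∧
    T.PosSemidef ∧ L.rank ≤ m ∧ M = L + T), ENNReal.ofReal T.trace

theorem _root_.Matrix.psdTail_le {L T : Matrix (Fin N) (Fin N) ℝ} {m : ℕ} (hL : L.PosSemidef)
    (hT : T.PosSemidef) (hr : L.rank ≤ m) : (L + T).psdTail m ≤ ENNReal.ofReal T.trace :=
  iInf₂_le_of_le L T (iInf_le_of_le ⟨hL, hT, hr, rfl⟩ le_rfl)

theorem _root_.Matrix.psdTail_zero (M : Matrix (Fin N) (Fin N) ℝ) :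
    ENNReal.ofReal M.trace ≤ M.psdTail 0 := by
  refine le_iInf₂ fun L T => le_iInf fun ⟨_, _, hr, h⟩ => ?_
  have : L = 0 := by
    rw [Nat.le_zero, rank, Module.finrank_eq_zero_iff_of_free] at hr
    have := LinearMap.range_eq_bot.1 (Submodule.subsingleton_iff_eq_bot.1 hr)
    exact Matrix.toLin'.injective (by simpa [Matrix.toLin'_apply'] using this)
  rw [h, this, zero_add]

/-- Averaging the bound of `exists_pivotElim_add` with weights `R s s / tr R` gives `tr T + (tr T tr
L + ‖L‖² - ‖L + T‖²) / tr R` in Frobenius norms. Since `‖L‖ ≤ ‖L + T‖` and `tr L ≤ tr R`, this is at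
most `2 tr T`. -/
theorem expect_step_psdTail_le {A : Matrix (Fin N) (Fin N) ℝ} {st : RPCState N i} (h : st.Valid A)
    (m : ℕ) : (st.step A).expect (fun st' => (st'.residual A).psdTail m) ≤
      2 * (st.residual A).psdTail (m + 1) := by
  rcases h.posSemidef.trace_nonneg.eq_or_lt with h0 | h0
  · rw [expect_step_of_trace_eq_zero h h0.symm, residual_idle,
      h.posSemidef.trace_eq_zero_iff.1 h0.symm]
    have := psdTail_le (N := N) (m := m) .zero .zero (by simp)
    simp only [trace_zero, ENNReal.ofReal_zero, add_zero] at this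
    exact this.trans (zero_le)
  -- The factor `2` moves to the left so that the right side is a bare infimum, to be bounded
  -- splitting by splitting.
  · rw [mul_comm, ← ENNReal.div_le_iff_le_mul (by simp) (by simp)]
    refine le_iInf₂ fun L T => le_iInf fun ⟨hL, hT, hr, hR⟩ => ?_
    rw [ENNReal.div_le_iff_le_mul (by simp) (by simp), mul_comm]
    have hd : ∀ s, 0 ≤ st.residual A s s := fun s => h.posSemidef.diag_nonneg
    rw [hR] at h0
    have hstep := expect_step_le h (by rwa [hR])
      (f := fun st' => (st'.residual A).psdTail m)
      (c := fun s => T.trace + (T s s * L.trace + ∑ j, L j s ^ 2 - ∑ j, (L + T) j s ^ 2) /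
        (L + T) s s) fun s hs => by
        have hs' := hs
        rw [hR] at hs'
        obtain ⟨L', T', hL', hT', hr', he, htr⟩ := hL.exists_pivotElim_add hT hr s hs'
        refine ⟨hT'.trace_nonneg.trans htr, ?_⟩
        rw [residual_update hs.le, hR, he]
        exact (psdTail_le hL' hT' hr').trans (ENNReal.ofReal_le_ofReal htr)
    refine hstep.trans ?_
    rw [show (2 : ℝ≥0∞) = ENNReal.ofReal 2 by simp, ← ENNReal.ofReal_mul zero_le_two]
    refine ENNReal.ofReal_le_ofReal ?_
    rw [hR] at hd ⊢
    rw [div_le_iff₀ h0]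
    have hterm : ∀ s, (L + T) s s * (T.trace + (T s s * L.trace + ∑ j, L j s ^ 2 -
        ∑ j, (L + T) j s ^ 2) / (L + T) s s) =
        (L + T) s s * T.trace + (T s s * L.trace + ∑ j, L j s ^ 2 - ∑ j, (L + T) j s ^ 2) := by
      intro s
      rcases eq_or_ne ((L + T) s s) 0 with hs | hs
      · have h1 := (hL.add hT).apply_eq_zero hs
        have h3 : L s s = 0 ∧ T s s = 0 := by
          have a1 : 0 ≤ L s s := hL.diag_nonneg
          have a2 : 0 ≤ T s s := hT.diag_nonneg
          rw [Matrix.add_apply] at hs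
          constructor <;> linarith
        simp only [h1, h3.2, hL.apply_eq_zero h3.1]
        simp
      · rw [mul_add, mul_div_cancel₀ _ hs]
    rw [Finset.sum_congr rfl fun s _ => hterm s]
    simp only [Finset.sum_add_distrib, Finset.sum_sub_distrib, ← Finset.sum_mul]
    have e1 : ∑ s, (L + T) s s = (L + T).trace := rfl
    have e2 : ∑ s, T s s = T.trace := rfl
    rw [e1, e2]
    have := hL.sum_sq_le_sum_sq_add hT
    have h3 : (L + T).trace = L.trace + T.trace := trace_add L T
    have := mul_nonneg hT.trace_nonneg hT.trace_nonneg
    rw [h3]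
    nlinarith

end Doubling

end RPCState

/-! ### Expectations after many iterations. -/

section Iteration

variable {N : ℕ} {A : Matrix (Fin N) (Fin N) ℝ}

theorem valid_of_mem_support_rpCholesky (hA : A.PosSemidef) {k : ℕ} {st : RPCState N k}
    (h : st ∈ (rpCholesky A k).support) : st.Valid A := by
  induction k with
  | zero =>
    rw [rpCholesky, PMF.support_pure, Set.mem_singleton_iff] at h
    exact h ▸ RPCState.valid_init hA
  | succ k ih =>
    rw [rpCholesky, PMF.mem_support_bind_iff] at h
    obtain ⟨st', h', hs⟩ := h
    exact (ih h').of_mem_support_step hs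

theorem expect_psdTail_rpCholesky_le (hA : A.PosSemidef) (i m : ℕ) :
    (rpCholesky A i).expect (fun st => (st.residual A).psdTail m) ≤
      2 ^ i * A.psdTail (m + i) := by
  -- The last iteration trades level `m` for level `m + 1` at the preceding state.
  induction i generalizing m with
  | zero => simp [rpCholesky, PMF.expect_pure, RPCState.residual_init]
  | succ i ih =>
    rw [rpCholesky, PMF.expect_bind]
    calc _ ≤ (rpCholesky A i).expect fun st => 2 * (st.residual A).psdTail (m + 1) :=
          PMF.expect_mono fun st hst =>
            RPCState.expect_step_psdTail_le (valid_of_mem_support_rpCholesky hA hst) m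
      _ ≤ 2 * (2 ^ i * A.psdTail (m + 1 + i)) := by
          rw [PMF.expect_const_mul]
          gcongr
          exact ih (m + 1)
      _ = _ := by rw [pow_succ', mul_assoc, add_right_comm, add_assoc]

variable {P : Matrix (Fin N) (Fin N) ℝ}

/-- The tail `tr ((1 - P) R)` is at most `tr ((1 - P) A)`, whichever pivots were drawn. -/
theorem trace_residual_le_head_add (hP : P.IsHermitian) (hPP : P * P = P) {k : ℕ}
    (st : RPCState N k) :
    (st.residual A).trace ≤ (P * st.residual A).trace + (A - P * A).trace := by
  have h := RPCState.trace_projector_residual_le (A := A) (st := st)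
    (isHermitian_one.sub hP) (IsIdempotentElem.one_sub hPP)
  rw [sub_mul, sub_mul, one_mul, one_mul, trace_sub] at h
  linarith

/-- Jensen's inequality through the affine majorant touching `headStep` at the current bound; its
nonnegative slope lets that bound replace the expected head. -/
theorem expect_head_add_le {r : ℕ} (hr1 : 1 ≤ r) (hA : A.PosSemidef) (hP : P.IsHermitian)
    (hPP : P * P = P) (hr : P.trace ≤ r) {b : ℝ} (hb : (A - P * A).trace = b) (hb0 : 0 ≤ b)
    {a : ℝ} (ha : 0 ≤ a) {m : ℕ}
    (hm : (rpCholesky A m).expect (fun st => ENNReal.ofReal (P * st.residual A).trace) ≤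
      ENNReal.ofReal a) (j : ℕ) :
    (rpCholesky A (m + j)).expect (fun st => ENNReal.ofReal (P * st.residual A).trace) ≤
      ENNReal.ofReal ((headStep r b)^[j] a) := by
  have hr1' : (1 : ℝ) ≤ r := by exact_mod_cast hr1
  induction j with
  | zero => exact hm
  | succ j ih =>
    have hx := iterate_headStep_nonneg hr1' hb0 ha j
    rw [Function.iterate_succ_apply']
    set x := (headStep r b)^[j] a
    obtain ⟨c, d, hc, hd, hcd, hle⟩ := exists_affine_headStep hr1' hb0 hx
    rw [← add_assoc, rpCholesky, PMF.expect_bind]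
    calc _ ≤ (rpCholesky A (m + j)).expect fun st =>
            ENNReal.ofReal c * ENNReal.ofReal (P * st.residual A).trace + ENNReal.ofReal d := by
          refine PMF.expect_mono fun st hst => ?_
          have hv := valid_of_mem_support_rpCholesky hA hst
          have hh := (posSemidef_of_isHermitian_of_mul_self hP hPP).trace_mul_nonneg hv.posSemidef
          refine (RPCState.expect_step_head_le hP hPP hr hv
            (hb ▸ trace_residual_le_head_add hP hPP st)).trans ?_
          rw [← ENNReal.ofReal_mul hc, ← ENNReal.ofReal_add (mul_nonneg hc hh) hd]
          exact ENNReal.ofReal_le_ofReal (hle _ hh)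
      _ ≤ ENNReal.ofReal c * ENNReal.ofReal x + ENNReal.ofReal d := by
          rw [PMF.expect_add, PMF.expect_const_mul, PMF.expect_const]
          gcongr
      _ = _ := by
          rw [← ENNReal.ofReal_mul hc, ← ENNReal.ofReal_add (mul_nonneg hc hx) hd, hcd]

/-- The expected trace of the residual in terms of the expected trace of its head. -/
theorem expect_trace_le_of_head (hA : A.PosSemidef) (hP : P.IsHermitian) (hPP : P * P = P) {k : ℕ}
    {b e : ℝ} (hb : (A - P * A).trace = b) (hb0 : 0 ≤ b) (he : 0 ≤ e)
    (h : (rpCholesky A k).expect (fun st => ENNReal.ofReal (P * st.residual A).trace) ≤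
      ENNReal.ofReal (e * b)) :
    (rpCholesky A k).expect (fun st => ENNReal.ofReal (st.residual A).trace) ≤
      ENNReal.ofReal ((1 + e) * b) := by
  calc _ ≤ (rpCholesky A k).expect fun st =>
          ENNReal.ofReal (P * st.residual A).trace + ENNReal.ofReal b := by
        refine PMF.expect_mono fun st hst => ?_
        have hv := valid_of_mem_support_rpCholesky hA hst
        have hh := (posSemidef_of_isHermitian_of_mul_self hP hPP).trace_mul_nonneg hv.posSemidef
        rw [← ENNReal.ofReal_add hh hb0]
        exact ENNReal.ofReal_le_ofReal (hb ▸ trace_residual_le_head_add hP hPP st)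
    _ ≤ ENNReal.ofReal (e * b) + ENNReal.ofReal b := by
        rw [PMF.expect_add, PMF.expect_const]
        gcongr
    _ = _ := by
        rw [← ENNReal.ofReal_add (by positivity) hb0]
        congr 1
        ring

/-- After `r` iterations the expected trace of the residual is at most `2 ^ r` times the optimum. -/
theorem expect_trace_rpCholesky_le_two_pow (hA : A.PosSemidef) (r : ℕ) :
    (rpCholesky A r).expect (fun st => ENNReal.ofReal (st.residual A).trace) ≤
      ENNReal.ofReal (2 ^ r * (A - truncEig hA.isHermitian r).trace) := by
  calc _ ≤ (rpCholesky A r).expect fun st => (st.residual A).psdTail 0 :=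
        PMF.expect_mono fun st _ => psdTail_zero _
    _ ≤ 2 ^ r * A.psdTail (0 + r) := expect_psdTail_rpCholesky_le hA r 0
    _ ≤ 2 ^ r * ENNReal.ofReal (A - truncEig hA.isHermitian r).trace := by
        gcongr
        have := psdTail_le (posSemidef_truncEig r hA) (posSemidef_sub_truncEig r hA)
          (rank_truncEig_le hA.isHermitian r)
        rw [add_sub_cancel] at this
        rwa [zero_add]
    _ = _ := by
        rw [ENNReal.ofReal_mul (by positivity), ENNReal.ofReal_pow zero_le_two]
        simp

theorem expect_trace_rpCholesky_le (hA : A.PosSemidef) (r : ℕ) {ε : ℝ} (hε : 0 < ε) {k : ℕ}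
    (hk : columnBound r ε (relErr hA.isHermitian r) ≤ (k : ℝ)) :
    (rpCholesky A k).expect (fun st => ENNReal.ofReal (st.residual A).trace) ≤
      ENNReal.ofReal ((1 + ε) * (A - truncEig hA.isHermitian r).trace) := by
  have hP := isHermitian_topProjector hA.isHermitian r
  have hPP := topProjector_mul_self hA.isHermitian r
  have hr := trace_topProjector_le hA.isHermitian r
  have hPA := topProjector_mul_eq_truncEig hA.isHermitian r
  have hb0 := (posSemidef_sub_truncEig r hA).trace_nonneg
  have hη : relErr hA.isHermitian r = (A - truncEig hA.isHermitian r).trace / A.trace := rfl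
  have htrA := hA.trace_nonneg
  have htwo := expect_trace_rpCholesky_le_two_pow hA r
  set P := topProjector hA.isHermitian r
  have hbP : (A - P * A).trace = (A - truncEig hA.isHermitian r).trace := by rw [hPA]
  set b := (A - truncEig hA.isHermitian r).trace
  set η := relErr hA.isHermitian r
  have hPpos := posSemidef_of_isHermitian_of_mul_self hP hPP
  have hhead : ∀ {m : ℕ}, ∀ st ∈ (rpCholesky A m).support,
      (P * st.residual A).trace ≤ (st.residual A).trace := fun st hst => by
    have hv := valid_of_mem_support_rpCholesky hA hst
    have := (posSemidef_of_isHermitian_of_mul_self (isHermitian_one.sub hP)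
      (IsIdempotentElem.one_sub hPP)).trace_mul_nonneg hv.posSemidef
    rw [sub_mul, trace_sub, one_mul] at this
    linarith
  refine expect_trace_le_of_head hA hP hPP hbP hb0 hε.le ?_
  -- For `r = 0` the head vanishes; the recursion lemmas need `r ≥ 1`.
  rcases Nat.eq_zero_or_pos r with rfl | hr1
  · have hP0 : P = 0 := hPpos.trace_eq_zero_iff.1 (le_antisymm (by simpa using hr) hPpos.trace_nonneg)
    simp [hP0, PMF.expect_const]
  have hr1' : (1 : ℝ) ≤ r := by exact_mod_cast hr1
  have finish : ∀ (m : ℕ) (c a : ℝ), 0 ≤ a → a ≤ c * b → m ≤ k →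
      (rpCholesky A m).expect (fun st => ENNReal.ofReal (P * st.residual A).trace) ≤
        ENNReal.ofReal a →
      m + (r / ε + r * max (Real.log (c / ε)) 0) ≤ k →
      (rpCholesky A k).expect (fun st => ENNReal.ofReal (P * st.residual A).trace) ≤
        ENNReal.ofReal (ε * b) := by
    intro m c a ha hac hmk hm hk
    obtain ⟨j, rfl⟩ := Nat.exists_eq_add_of_le hmk
    refine (expect_head_add_le hr1 hA hP hPP hr hbP hb0 ha hm j).trans
      (ENNReal.ofReal_le_ofReal (iterate_headStep_le hr1' hb0 hε ha hac j ?_))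
    push_cast at hk
    linarith
  have hsecond : r / ε + (r + r * max (Real.log (2 ^ r / ε)) 0) ≤ (k : ℝ) →
      (rpCholesky A k).expect (fun st => ENNReal.ofReal (P * st.residual A).trace) ≤
        ENNReal.ofReal (ε * b) := by
    intro h
    refine finish r (2 ^ r) (2 ^ r * b) (by positivity) le_rfl ?_ ?_ (by linarith)
    · have h1 : 0 ≤ r / ε := by positivity
      have h2 : 0 ≤ r * max (Real.log (2 ^ r / ε)) 0 :=
        mul_nonneg (by positivity) (le_max_right _ _)
      exact_mod_cast (by linarith : (r : ℝ) ≤ k)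
    · exact (PMF.expect_mono fun st hst => ENNReal.ofReal_le_ofReal (hhead st hst)).trans htwo
  rw [columnBound] at hk
  split_ifs at hk with h0
  · exact hsecond hk
  · rcases min_choice (r * max (Real.log (1 / (ε * η))) 0)
      (r + r * max (Real.log (2 ^ r / ε)) 0) with hmin | hmin <;> rw [hmin] at hk
    -- Start at time `0` with `a = tr A = b / η`; `η ≠ 0` ensures that `tr A` and `b` are nonzero.
    · refine finish 0 (1 / η) A.trace htrA ?_ (Nat.zero_le k) ?_ ?_
      · have hA0 : A.trace ≠ 0 := fun h => h0 (by rw [hη, h, div_zero])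
        have hbne : b ≠ 0 := fun h => h0 (by rw [hη, h, zero_div])
        rw [hη]
        field_simp
        exact le_rfl
      · rw [rpCholesky, PMF.expect_pure]
        refine ENNReal.ofReal_le_ofReal ?_
        have := hhead (RPCState.init A) (m := 0) (by simp [rpCholesky])
        rwa [RPCState.residual_init] at this ⊢
      · rw [Nat.cast_zero, zero_add, div_div, mul_comm η ε]
        exact hk
    · exact hsecond hk

end Iteration

/-! ### Passage to the real-valued integral. -/

theorem theorem3p1 (r : ℕ) (ε : ℝ) (hε : 0 < ε) (N : ℕ) (A : Matrix (Fin N) (Fin N) ℝ)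
    (hA : A.PosSemidef) (k : ℕ) (hk : columnBound r ε (relErr hA.isHermitian r) ≤ (k : ℝ)) :
    MeasureTheory.Integrable (fun st : RPCState N k => (A - st.approx).trace)
        (rpCholesky A k).toMeasure ∧
      ∫ st : RPCState N k, (A - st.approx).trace ∂(rpCholesky A k).toMeasure ≤
        (1 + ε) * (A - truncEig hA.isHermitian r).trace := by
  have : MeasurableSingletonClass (RPCState N k) := ⟨fun _ => trivial⟩
  have hmeas : Measurable (fun st : RPCState N k => (A - st.approx).trace) := measurable_from_top
  have hnn : 0 ≤ᵐ[(rpCholesky A k).toMeasure] fun st : RPCState N k => (A - st.approx).trace :=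
    PMF.ae_toMeasure_of_support fun st hst =>
      (valid_of_mem_support_rpCholesky hA hst).posSemidef.trace_nonneg
  have hle : ∫⁻ st : RPCState N k, ENNReal.ofReal (A - st.approx).trace
      ∂(rpCholesky A k).toMeasure ≤
        ENNReal.ofReal ((1 + ε) * (A - truncEig hA.isHermitian r).trace) := by
    rw [PMF.lintegral_toMeasure]
    exact expect_trace_rpCholesky_le hA r hε hk
  have hb0 := (posSemidef_sub_truncEig r hA).trace_nonneg
  refine ⟨⟨hmeas.aestronglyMeasurable, ?_⟩, ?_⟩
  · rw [MeasureTheory.hasFiniteIntegral_iff_ofReal hnn]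
    exact hle.trans_lt ENNReal.ofReal_lt_top
  · rw [MeasureTheory.integral_eq_lintegral_of_nonneg_ae hnn hmeas.aestronglyMeasurable]
    exact ENNReal.toReal_le_of_le_ofReal (by positivity) hle
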